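/- Theorem. Let $1<\alpha\le 2$, $a<b$, $T>0$, let $M,N\ge 1$ be integers, $h=(b-a)/M$, $\tau=T/N$, $x_j=a+jh$ ($j\in\mathbb Z$), and let $\beta_s,\eta_s,\zeta_s>0$, $\mu_s\ge 0$, $\gamma_s\in\mathbb R$ ($s=1,2$). Put $$b_0=\tfrac{3\alpha-2}{2\alpha},\quad b_1=-\tfrac{2(\alpha-1)}{\alpha},\quad b_2=\tfrac{\alpha-2}{2\alpha},\quad \eta=\tfrac{(3\alpha-2)(\alpha-2)(\alpha-1)}{24\alpha},\quad \varrho=\tfrac{3\alpha^3-19\alpha^2+36\alpha-16}{24\alpha},$$ and let $\kappa_m$ be the coefficients of the power series at $0$ of $$G_4(z)=\bigl[1+\eta(b_0+b_1z+b_2z^2)^2\bigr](b_0+b_1z+b_2z^2)^{\alpha}=\sum_{m\ge0}\kappa_m z^m .$$ For grid functions $W=(W_j)_{j\in\mathbb Z}$ with complex values and $1\le j\le M-1$ define $$(\mathcal H W)_j=W_j+\varrho\,(W_{j+1}-2W_j+W_{j-1}),$$ $$(\mathcal A W)_j=-\frac{1}{2h^{\alpha}\cos(\pi\alpha/2)}\Bigl(\sum_{m=0}^{j}\kappa_mW_{j-m+1}+\sum_{m=0}^{M-j}\kappa_mW_{j+m-1}\Bigr).$$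 For a sequence $W^k=(W^k_j)_{j\in\mathbb Z}$ write $\delta_tW_j^{k+1/2}=(W_j^{k+1}-W_j^k)/\tau$ and $W_j^{k+1/2}=(W_j^{k+1}+W_j^k)/2$. Let $u_0,v_0:\mathbb R\to\mathbb C$ vanish outside $(a,b)$. Assume that there are $\epsilon_1,\epsilon_2,\epsilon_3,\epsilon_4>0$ with $$\mu_1\ge\epsilon_1^2+\frac{1}{16\epsilon_1^2\epsilon_2^2}+\frac{\epsilon_4^2}{4\epsilon_3^2},\qquad \mu_2\ge\epsilon_3^2+\frac{1}{16\epsilon_3^2\epsilon_4^2}+\frac{\epsilon_2^2}{4\epsilon_1^2},$$ and that $\tau\gamma\le\frac12$, where $\gamma=\max\{|\gamma_1|,|\gamma_2|\}$. Then the implicit nonlinear difference scheme $$\mathcal H\delta_tU^{k+1/2}_j=\bigl[(\beta_1+\mathrm i\eta_1)\mathcal A+\gamma_1\mathcal H\bigr]U^{k+1/2}_j-(\mu_1+\mathrm i\zeta_1)\mathcal H\bigl(|U^{k+1/2}|^2U^{k+1/2}\bigr)_j+\mathrm i\,\mathcal H\bigl(|U^{k+1/2}|^2V^{k+1/2}\bigr)_j,$$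 $$\mathcal H\delta_tV^{k+1/2}_j=\bigl[(\beta_2+\mathrm i\eta_2)\mathcal A+\gamma_2\mathcal H\bigr]V^{k+1/2}_j-(\mu_2+\mathrm i\zeta_2)\mathcal H\bigl(|V^{k+1/2}|^2V^{k+1/2}\bigr)_j+\mathrm i\,\mathcal H\bigl(|V^{k+1/2}|^2U^{k+1/2}\bigr)_j$$ for $1\le j\le M-1$, $0\le k\le N-1$, with initial values $U^0_j=u_0(x_j)$, $V^0_j=v_0(x_j)$ for $j\in\mathbb Z$ and boundary values $U^k_j=V^k_j=0$ for $j\in\mathbb Z\setminus\{1,\dots,M-1\}$, $0\le k\le N$, has a solution $(U^k,V^k)$, $0\le k\le N$. -/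

import Mathlib

namespace CoupledGL

noncomputable section

/-! Coefficients of the fourth-order fractional difference formula. -/

/-- `b₀ = (3α - 2) / (2α)` -/
def b0 (α : ℝ) : ℝ := (3 * α - 2) / (2 * α)

/-- `b₁ = -2 (α - 1) / α` -/
def b1 (α : ℝ) : ℝ := -(2 * (α - 1) / α)

/-- `b₂ = (α - 2) / (2α)` -/
def b2 (α : ℝ) : ℝ := (α - 2) / (2 * α)

/-- `η = (3α - 2)(α - 2)(α - 1) / (24 α)` -/
def etaCoeff (α : ℝ) : ℝ := (3 * α - 2) * (α - 2) * (α - 1) / (24 * α)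

/-- The generating function `G₂(z) = (b₀ + b₁ z + b₂ z²)^α`. -/
def G2 (α z : ℝ) : ℝ := (b0 α + b1 α * z + b2 α * z ^ 2) ^ α

/-- The generating function `G₄(z) = [1 + η (b₀ + b₁ z + b₂ z²)²] G₂(z)`. -/
def G4 (α z : ℝ) : ℝ :=
  (1 + etaCoeff α * (b0 α + b1 α * z + b2 α * z ^ 2) ^ 2) * G2 α z

/-- `κ_{4,m}^{(α)}`: the `m`-th coefficient of the power series of `G₄` at `0`.
Since `b₀ > 0` for `α > 1`, the function `G₄` is real analytic near `0`. -/
def kappa4 (α : ℝ) (m : ℕ) : ℝ := iteratedDeriv m (G4 α) 0 / (m.factorial : ℝ)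

/-- `ϱ₂^{(α)} = (3α³ - 19α² + 36α - 16) / (24 α)`, the coefficient of `z²` in the expansion
of `e^z z^{-α} G₄(e^{-z})`. -/
def rho2 (α : ℝ) : ℝ := (3 * α ^ 3 - 19 * α ^ 2 + 36 * α - 16) / (24 * α)

/-! Difference operators on grid functions `U : ℤ → ℂ`; `U j` is the value at `x_j = a + j h`. -/

/-- The central second difference `δ_x² U_j = (U_{j+1} - 2 U_j + U_{j-1}) / h²`. -/
def deltaX2 (h : ℝ) (U : ℤ → ℂ) (j : ℤ) : ℂ :=
  (U (j + 1) - 2 * U j + U (j - 1)) / (h : ℂ) ^ 2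

/-- The compact operator `ℋ_h^α = 1 + ϱ₂^{(α)} h² δ_x²`. -/
def opH (α h : ℝ) (U : ℤ → ℂ) (j : ℤ) : ℂ :=
  U j + (rho2 α : ℂ) * (h : ℂ) ^ 2 * deltaX2 h U j

/-- The left operator
`h^{-α} ∑_{m=0}^{⌊(x-a)/h⌋} κ_{4,m} u(x - (m-1)h)` at `x = x_j`, where `⌊(x_j-a)/h⌋ = j`. -/
def opAL (α h : ℝ) (U : ℤ → ℂ) (j : ℤ) : ℂ :=
  ((h ^ α : ℝ) : ℂ)⁻¹ *
    ∑ m ∈ Finset.range (j.toNat + 1), (kappa4 α m : ℂ) * U (j - ((m : ℤ) - 1))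

/-- The right operator
`h^{-α} ∑_{m=0}^{⌊(b-x)/h⌋} κ_{4,m} u(x + (m-1)h)` at `x = x_j`, where `⌊(b-x_j)/h⌋ = M - j`. -/
def opAR (α h : ℝ) (M : ℕ) (U : ℤ → ℂ) (j : ℤ) : ℂ :=
  ((h ^ α : ℝ) : ℂ)⁻¹ *
    ∑ m ∈ Finset.range (((M : ℤ) - j).toNat + 1), (kappa4 α m : ℂ) * U (j + ((m : ℤ) - 1))

/-- `𝒜_h^α = -(1 / (2 cos(πα/2))) (left operator + right operator)`. -/
def opA (α h : ℝ) (M : ℕ) (U : ℤ → ℂ) (j : ℤ) : ℂ :=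
  ((-(1 / (2 * Real.cos (Real.pi * α / 2))) : ℝ) : ℂ) * (opAL α h U j + opAR α h M U j)

/-- The time difference quotient `δ_t U^{k+1/2} = (U^{k+1} - U^k) / τ`. -/
def deltaT (τ : ℝ) (U : ℕ → ℤ → ℂ) (k : ℕ) (j : ℤ) : ℂ :=
  (U (k + 1) j - U k j) / (τ : ℂ)

/-- The midpoint value `U^{k+1/2} = (U^{k+1} + U^k) / 2`. -/
def mid (U : ℕ → ℤ → ℂ) (k : ℕ) (j : ℤ) : ℂ := (U (k + 1) j + U k j) / 2

/-- The grid function `|U|² W`. -/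
def sqMul (U W : ℤ → ℂ) (j : ℤ) : ℂ := ((‖U j‖ ^ 2 : ℝ) : ℂ) * W j

/-- One of the two equations of the scheme, at time step `k` and grid point `j`: the equation
for the unknown `U`, coupled to the other unknown `W`. -/
def SchemeEq (α h τ : ℝ) (M : ℕ) (β η μ ζ γ : ℝ) (U W : ℕ → ℤ → ℂ) (k : ℕ) (j : ℤ) : Prop :=
  opH α h (deltaT τ U k) j =
    ((β : ℂ) + Complex.I * (η : ℂ)) * opA α h M (mid U k) j
      + (γ : ℂ) * opH α h (mid U k) j
      - ((μ : ℂ) + Complex.I * (ζ : ℂ)) * opH α h (sqMul (mid U k) (mid U k)) j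
      + Complex.I * opH α h (sqMul (mid U k) (mid W k)) j

/-- `(U^k, V^k)`, `0 ≤ k ≤ N`, solves the implicit difference scheme on `[a, b] × [0, T]` with
`M` space intervals and `N` time steps, i.e. `h = (b - a) / M` and `τ = T / N`. -/
structure IsSchemeSolution (a b T : ℝ) (M N : ℕ) (α : ℝ)
    (β₁ β₂ η₁ η₂ μ₁ μ₂ ζ₁ ζ₂ γ₁ γ₂ : ℝ) (u₀ v₀ : ℝ → ℂ) (U V : ℕ → ℤ → ℂ) : Prop where
  eqU : ∀ k : ℕ, k < N → ∀ j : ℤ, 1 ≤ j → j ≤ (M : ℤ) - 1 →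
    SchemeEq α ((b - a) / M) (T / N) M β₁ η₁ μ₁ ζ₁ γ₁ U V k j
  eqV : ∀ k : ℕ, k < N → ∀ j : ℤ, 1 ≤ j → j ≤ (M : ℤ) - 1 →
    SchemeEq α ((b - a) / M) (T / N) M β₂ η₂ μ₂ ζ₂ γ₂ V U k j
  initU : ∀ j : ℤ, U 0 j = u₀ (a + (j : ℝ) * ((b - a) / M))
  initV : ∀ j : ℤ, V 0 j = v₀ (a + (j : ℝ) * ((b - a) / M))
  bdryU : ∀ k : ℕ, k ≤ N → ∀ j : ℤ, ¬ (1 ≤ j ∧ j ≤ (M : ℤ) - 1) → U k j = 0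
  bdryV : ∀ k : ℕ, k ≤ N → ∀ j : ℤ, ¬ (1 ≤ j ∧ j ≤ (M : ℤ) - 1) → V k j = 0

end

end CoupledGL

/-!
At every time step the scheme is a finite system for the midpoint values `X`, `Y` on the interior
grid points. The compact operator is strictly diagonally dominant there, because `rho2 α < 1 / 4`
(`injective_compress_opHLinear`); after multiplication by its inverse the nonlinearity becomes
pointwise (`cubicTerm`) and all remaining terms, including the fractional operator, are affine.

Paired with `(X, Y)`, the nonlinearity at one grid point has real part
`μ₁ |x|⁴ + μ₂ |y|⁴ + (|x|² - |y|²) Im (y x̄)`. By Young's inequality the conditions on `μ₁` and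
`μ₂` say that `μ₁ r⁴ + μ₂ s⁴` dominates a sum of upper bounds for `r³ s` and for `r s³`, while the
coupling is at most the larger of these two, so the form is bounded below by `c (|x|⁴ + |y|⁴)` with
`c > 0` (`exists_quartic_lower_bound`). Hence far from the origin the quartic form dominates every
affine contribution, and the vector field whose zeros are the midpoint values points outwards.

Such a `C¹` vector field has a zero (`exists_zero_of_inner_pos`), by the no-retraction theorem
(`not_exists_contDiff_retraction_sphere`). That theorem is proved by the analytic argument of
Milnor and Rogers: for a retraction `f` of a ball onto its boundary, the maps
`x ↦ x + t (f x - x)` are bijections of the ball for small `t > 0`, so that the integral of their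
Jacobian determinant, a polynomial in `t`, is constantly the volume of the ball, although it
vanishes at `t = 1`.
-/

namespace CoupledGL

open MeasureTheory Metric Set Topology

/-! ### Retractions onto spheres and zeros of outward vector fields -/

section Retraction

variable {E : Type*} [NormedAddCommGroup E] [InnerProductSpace ℝ E] [FiniteDimensional ℝ E]

lemma det_one_add_ne_zero_of_norm_lt_one {A : E →L[ℝ] E} (hA : ‖A‖ < 1) :
    (1 + A : E →L[ℝ] E).det ≠ 0 := by
  intro h
  obtain ⟨v, hv, hv0⟩ := (Submodule.ne_bot_iff _).1 (LinearMap.bot_lt_ker_of_det_eq_zero h).ne'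
  have hv' : v + A v = 0 := by simpa using hv
  have h1 : ‖v‖ = ‖A v‖ := by simpa using congrArg norm (eq_neg_of_add_eq_zero_left hv')
  have h2 := A.le_opNorm v
  have h3 : 0 < ‖v‖ := norm_pos_iff.2 hv0
  nlinarith

/-- Along the segment from `1` to `1 + A` the determinant never vanishes, so it keeps the sign it
has at `1`. -/
lemma det_one_add_pos_of_norm_lt_one {A : E →L[ℝ] E} (hA : ‖A‖ < 1) :
    0 < (1 + A : E →L[ℝ] E).det := by
  by_contra! hneg
  have hc : Continuous fun s : ℝ => (1 + s • A : E →L[ℝ] E).det :=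
    ContinuousLinearMap.continuous_det.comp (by fun_prop)
  have h0 : (1 + (0 : ℝ) • A : E →L[ℝ] E).det = 1 := by
    simp [ContinuousLinearMap.det]
  obtain ⟨s, hs, hs0⟩ := intermediate_value_Icc' (zero_le_one' ℝ) hc.continuousOn
    (show (0 : ℝ) ∈ Icc _ _ from ⟨by simpa using hneg, by rw [h0]; exact zero_le_one⟩)
  refine det_one_add_ne_zero_of_norm_lt_one ?_ hs0
  rw [norm_smul, Real.norm_of_nonneg hs.1]
  nlinarith [hs.2, norm_nonneg A]

/-- `det (1 + t A)` is a polynomial in `t` of degree at most `dim E`, so its value at `t = 1` is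
given by Lagrange interpolation. -/
lemma det_one_add_eq_sum_lagrange (A : E →L[ℝ] E) (s : Finset ℝ)
    (hs : Module.finrank ℝ E < s.card) :
    (1 + A : E →L[ℝ] E).det =
      ∑ t ∈ s, (1 + t • A : E →L[ℝ] E).det * (Lagrange.basis s id t).eval 1 := by
  let b := Module.finBasis ℝ E
  let m := LinearMap.toMatrix b b (A : E →ₗ[ℝ] E)
  let p : Polynomial ℝ :=
    ((Polynomial.X : Polynomial ℝ) • m.map (Polynomial.C : ℝ → Polynomial ℝ) +
      (1 : Matrix _ _ ℝ).map (Polynomial.C : ℝ → Polynomial ℝ)).det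
  have hp (t : ℝ) : (1 + t • A : E →L[ℝ] E).det = p.eval t := by
    have h1 : (1 + t • A : E →L[ℝ] E).det =
        (LinearMap.toMatrix b b ((1 + t • A : E →L[ℝ] E) : E →ₗ[ℝ] E)).det := by
      rw [LinearMap.det_toMatrix]
    have h2 : LinearMap.toMatrix b b ((1 + t • A : E →L[ℝ] E) : E →ₗ[ℝ] E) = 1 + t • m := by
      have : ((1 + t • A : E →L[ℝ] E) : E →ₗ[ℝ] E) = LinearMap.id + t • (A : E →ₗ[ℝ] E) := by
        ext; simp
      rw [this, map_add, map_smul, LinearMap.toMatrix_id]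
    rw [h1, h2]
    simp only [p]
    rw [← Polynomial.coe_evalRingHom, RingHom.map_det]
    congr 1
    ext i j
    simp [Matrix.one_apply, apply_ite, add_comm]
    ring
  have hdeg : p.degree < s.card := by
    refine lt_of_le_of_lt Polynomial.degree_le_natDegree ?_
    have := Polynomial.natDegree_det_X_add_C_le m 1
    simp only [Fintype.card_fin] at this
    exact_mod_cast this.trans_lt hs
  have hL := Lagrange.eq_interpolate_of_eval_eq (s := s) (v := id) (f := p) (fun t => p.eval t)
    Function.injective_id.injOn hdeg (fun _ _ => rfl)
  have h1 := hp 1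
  rw [one_smul] at h1
  rw [h1]
  conv_lhs => rw [hL]
  rw [Lagrange.interpolate_apply, Polynomial.eval_finsetSum]
  simp [hp]

/-- The differential of a map into a sphere takes values in the orthogonal complement of the
position vector. -/
lemma det_fderiv_eq_zero_of_norm_eq {f : E → E} {K : ℝ} (hK : 0 < K) (hf : Differentiable ℝ f)
    (hS : ∀ x, ‖f x‖ = K) (x : E) : (fderiv ℝ f x).det = 0 := by
  have hort (v : E) : inner ℝ (f x) (fderiv ℝ f x v) = 0 := by
    have h1 := (hf x).hasFDerivAt.norm_sq
    have h2 : HasFDerivAt (fun y => ‖f y‖ ^ 2) (0 : E →L[ℝ] ℝ) x := by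
      simp only [hS]; exact hasFDerivAt_const _ _
    have h3 := congrArg (fun l : E →L[ℝ] ℝ => l v) (h1.unique h2)
    simpa using h3
  by_contra hdet
  have hu : LinearMap.range (fderiv ℝ f x : E →ₗ[ℝ] E) = ⊤ :=
    LinearMap.range_eq_top.2
      (LinearMap.equivOfDetNeZero (fderiv ℝ f x : E →ₗ[ℝ] E) hdet).surjective
  obtain ⟨v, hv⟩ : f x ∈ LinearMap.range (fderiv ℝ f x : E →ₗ[ℝ] E) := hu ▸ Submodule.mem_top
  have h := hort v
  have hv' : fderiv ℝ f x v = f x := hv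
  rw [hv', real_inner_self_eq_norm_sq, hS] at h
  exact (pow_pos hK 2).ne' h

/-- For small `t > 0` the map `x ↦ x + t (f x - x)` carries the open ball bijectively onto itself:
it is injective as a small Lipschitz perturbation of the identity, and its image is open and
relatively closed in the ball. -/
lemma exists_bijOn_ball_of_retraction {f : E → E} {K : ℝ} (hK : 0 < K) (hf : ContDiff ℝ 1 f)
    (hS : ∀ x, ‖f x‖ = K) (hid : ∀ x, ‖x‖ = K → f x = x) :
    ∃ δ : ℝ, 0 < δ ∧ ∀ t ∈ Ioo 0 δ, InjOn (fun x => x + t • (f x - x)) (ball 0 K) ∧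
      (fun x => x + t • (f x - x)) '' ball 0 K = ball 0 K ∧
      ∀ x ∈ ball (0 : E) K, 0 < (1 + t • (fderiv ℝ f x - 1) : E →L[ℝ] E).det := by
  have hfd : Differentiable ℝ f := hf.differentiable one_ne_zero
  have hcont : Continuous fun x => ‖fderiv ℝ f x - 1‖ :=
    ((hf.continuous_fderiv one_ne_zero).sub continuous_const).norm
  obtain ⟨C, hC⟩ := ((isCompact_closedBall (0 : E) K).bddAbove_image hcont.continuousOn)
  have hC' (x : E) (hx : x ∈ closedBall (0 : E) K) : ‖fderiv ℝ f x - 1‖ ≤ C :=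
    hC (mem_image_of_mem _ hx)
  have hC0 : 0 ≤ C := (norm_nonneg _).trans (hC' 0 (mem_closedBall_self hK.le))
  have hder (t : ℝ) (x : E) : HasFDerivAt (fun x => x + t • (f x - x))
      (1 + t • (fderiv ℝ f x - 1) : E →L[ℝ] E) x :=
    (hasFDerivAt_id x).add (((hfd x).hasFDerivAt.sub (hasFDerivAt_id x)).const_smul t)
  refine ⟨min 1 (1 / (C + 1)), by positivity, fun t ht => ?_⟩
  have ht0 : 0 < t := ht.1
  have ht1 : t < 1 := ht.2.trans_le (min_le_left _ _)
  have htC : t * C < 1 := by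
    have : t < 1 / (C + 1) := ht.2.trans_le (min_le_right _ _)
    rw [lt_div_iff₀ (by linarith)] at this
    nlinarith
  have hsmall (x : E) (hx : x ∈ closedBall (0 : E) K) : ‖t • (fderiv ℝ f x - 1)‖ < 1 := by
    rw [norm_smul, Real.norm_of_nonneg ht0.le]
    exact (mul_le_mul_of_nonneg_left (hC' x hx) ht0.le).trans_lt htC
  have hinj : InjOn (fun x => x + t • (f x - x)) (ball 0 K) := by
    intro x hx y hy hxy
    have hlip : ‖(f y - y) - (f x - x)‖ ≤ C * ‖y - x‖ :=
      (convex_closedBall (0 : E) K).norm_image_sub_le_of_norm_hasFDerivWithin_le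
        (f := fun x => f x - x) (f' := fun x => fderiv ℝ f x - 1)
        (fun z _ => ((hfd z).hasFDerivAt.sub (hasFDerivAt_id z)).hasFDerivWithinAt) hC'
        (ball_subset_closedBall hx) (ball_subset_closedBall hy)
    have h1 : y - x = -(t • ((f y - y) - (f x - x))) := by
      have : x + t • (f x - x) = y + t • (f y - y) := hxy
      have h : y - x = t • (f x - x) - t • (f y - y) := by
        rw [sub_eq_sub_iff_add_eq_add, ← this, add_comm]
      rw [h, ← smul_sub, ← smul_neg, neg_sub]
    have h2 : ‖y - x‖ ≤ t * (C * ‖y - x‖) := by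
      conv_lhs => rw [h1, norm_neg, norm_smul, Real.norm_of_nonneg ht0.le]
      exact mul_le_mul_of_nonneg_left hlip ht0.le
    have h3 : ‖y - x‖ = 0 := by
      by_contra h
      have := (norm_nonneg (y - x)).lt_of_ne' h
      nlinarith
    exact (sub_eq_zero.1 (norm_eq_zero.1 h3)).symm
  have hcF : Continuous fun x => x + t • (f x - x) := by
    have := hf.continuous
    fun_prop
  -- For `t < 1`, a convex combination of a point of the open ball and a point of the sphere lies in
  -- the open ball.
  have hmaps : (fun x => x + t • (f x - x)) '' ball 0 K ⊆ ball 0 K := by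
    rintro _ ⟨x, hx, rfl⟩
    rw [mem_ball_zero_iff] at hx ⊢
    have : x + t • (f x - x) = (1 - t) • x + t • f x := by module
    simp only [this]
    refine (norm_add_le _ _).trans_lt ?_
    rw [norm_smul, norm_smul, Real.norm_of_nonneg ht0.le, Real.norm_of_nonneg (by linarith), hS]
    nlinarith
  have hopen : IsOpen ((fun x => x + t • (f x - x)) '' ball 0 K) := by
    refine isOpen_iff_mem_nhds.2 ?_
    rintro _ ⟨x, hx, rfl⟩
    have hstrict : HasStrictFDerivAt (fun x => x + t • (f x - x))
        (1 + t • (fderiv ℝ f x - 1) : E →L[ℝ] E) x := by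
      have hcd : ContDiff ℝ 1 fun x => x + t • (f x - x) := by fun_prop
      exact hcd.contDiffAt.hasStrictFDerivAt' (hder t x) one_ne_zero
    have hdet := det_one_add_ne_zero_of_norm_lt_one (hsmall x (ball_subset_closedBall hx))
    rw [← hstrict.map_nhds_eq_of_surj (LinearMap.range_eq_top.2
      (LinearMap.equivOfDetNeZero ((1 + t • (fderiv ℝ f x - 1) : E →L[ℝ] E) : E →ₗ[ℝ] E)
        hdet).surjective)]
    exact Filter.image_mem_map (isOpen_ball.mem_nhds hx)
  refine ⟨hinj, hmaps.antisymm ?_, fun x hx =>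
    det_one_add_pos_of_norm_lt_one (hsmall x (ball_subset_closedBall hx))⟩
  refine (convex_ball (0 : E) K).isPreconnected.subset_of_closure_inter_subset hopen ?_ ?_
  · have h0 : (0 : E) ∈ ball (0 : E) K := mem_ball_self hK
    exact ⟨_, hmaps (mem_image_of_mem _ h0), mem_image_of_mem _ h0⟩
  · rintro y ⟨hy, hyK⟩
    have hcl : closure ((fun x => x + t • (f x - x)) '' ball 0 K) ⊆
        (fun x => x + t • (f x - x)) '' closedBall 0 K :=
      closure_minimal (image_mono ball_subset_closedBall)
        ((isCompact_closedBall _ _).image hcF).isClosed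
    obtain ⟨x, hx, rfl⟩ := hcl hy
    refine ⟨x, ?_, rfl⟩
    rw [mem_closedBall_zero_iff] at hx
    rw [mem_ball_zero_iff] at hyK ⊢
    -- The map fixes the sphere, so a point of the open ball cannot come from the sphere.
    refine hx.lt_of_ne fun h => hyK.ne ?_
    simp [hid x h, h]

/-- There is no `C¹` retraction of a ball onto its boundary sphere. With
`F t x = x + t (f x - x)`, the integral over the ball of the Jacobian determinant of `F t` is a
polynomial in `t` which equals the volume of the ball for all small `t > 0`, hence also for `t = 1`,
where the Jacobian determinant vanishes. -/
theorem not_exists_contDiff_retraction_sphere {f : E → E} {K : ℝ} (hK : 0 < K)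
    (hf : ContDiff ℝ 1 f) (hS : ∀ x, ‖f x‖ = K) (hid : ∀ x, ‖x‖ = K → f x = x) : False := by
  borelize E
  obtain ⟨δ, hδ, H⟩ := exists_bijOn_ball_of_retraction hK hf hS hid
  have hfd : Differentiable ℝ f := hf.differentiable one_ne_zero
  -- Interpolation nodes in the range of `t` where the map is a bijection of the ball.
  obtain ⟨s, hsub, hcard⟩ :=
    (Ioo_infinite hδ).exists_subset_card_eq (Module.finrank ℝ E + 1)
  have hcard' : Module.finrank ℝ E < s.card := by omega
  have hcontdet (t : ℝ) :
      Continuous fun x => (1 + t • (fderiv ℝ f x - 1) : E →L[ℝ] E).det := by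
    have := hf.continuous_fderiv one_ne_zero
    exact ContinuousLinearMap.continuous_det.comp (by fun_prop)
  have hint (t : ℝ) : IntegrableOn
      (fun x => (1 + t • (fderiv ℝ f x - 1) : E →L[ℝ] E).det) (ball 0 K) :=
    ((hcontdet t).continuousOn.integrableOn_compact (isCompact_closedBall 0 K)).mono_set
      ball_subset_closedBall
  have hvol (t : ℝ) (ht : t ∈ s) :
      ∫ x in ball (0 : E) K, (1 + t • (fderiv ℝ f x - 1) : E →L[ℝ] E).det =
        volume.real (ball (0 : E) K) := by
    obtain ⟨hinj, himg, hpos⟩ := H t (hsub ht)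
    have h1 := integral_image_eq_integral_abs_det_fderiv_smul volume
      (measurableSet_ball (x := (0 : E)) (ε := K))
      (f' := fun x => (1 + t • (fderiv ℝ f x - 1) : E →L[ℝ] E))
      (fun x _ => ((hasFDerivAt_id x).add
        (((hfd x).hasFDerivAt.sub (hasFDerivAt_id x)).const_smul t)).hasFDerivWithinAt) hinj
      (fun _ => (1 : ℝ))
    rw [show (id + t • (f - id)) = fun x => x + t • (f x - x) from rfl, himg] at h1
    rw [setIntegral_const, smul_eq_mul, mul_one] at h1
    rw [h1]
    refine setIntegral_congr_fun measurableSet_ball fun x hx => ?_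
    simp [abs_of_pos (hpos x hx)]
  have hzero (x : E) : (fderiv ℝ f x).det = 0 := det_fderiv_eq_zero_of_norm_eq hK hfd hS x
  have hsum (x : E) : 0 = ∑ t ∈ s, (1 + t • (fderiv ℝ f x - 1) : E →L[ℝ] E).det *
      (Lagrange.basis s id t).eval 1 := by
    rw [← det_one_add_eq_sum_lagrange _ s hcard', add_sub_cancel, hzero]
  have hfin : (0 : ℝ) = volume.real (ball (0 : E) K) := by
    calc (0 : ℝ) = ∫ x in ball (0 : E) K, (0 : ℝ) := by simp
      _ = ∫ x in ball (0 : E) K, ∑ t ∈ s, (1 + t • (fderiv ℝ f x - 1) : E →L[ℝ] E).det *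
            (Lagrange.basis s id t).eval 1 := by
          congr 1; ext x; exact hsum x
      _ = ∑ t ∈ s, volume.real (ball (0 : E) K) * (Lagrange.basis s id t).eval 1 := by
          rw [integral_finsetSum _ fun t _ => (hint t).mul_const _]
          exact Finset.sum_congr rfl fun t ht => by rw [integral_mul_const, hvol t ht]
      _ = volume.real (ball (0 : E) K) := by
          rw [← Finset.mul_sum, ← Polynomial.eval_finsetSum,
            Lagrange.sum_basis Function.injective_id.injOn (Finset.card_pos.1 (by omega))]
          simp
  have hpos : 0 < volume.real (ball (0 : E) K) :=
    ENNReal.toReal_pos (measure_ball_pos volume _ hK).ne' measure_ball_lt_top.ne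
  exact hpos.ne hfin

/-- A `C¹` vector field on a Euclidean space that points outwards far from the origin has a zero:
otherwise, modified far out to be the identity and normalised, it would be a retraction onto a
sphere. -/
theorem exists_zero_of_inner_pos {F : E → E} (hF : ContDiff ℝ 1 F) {R : ℝ}
    (hpos : ∀ x, R ≤ ‖x‖ → 0 < inner ℝ (F x) x) : ∃ x, F x = 0 := by
  by_contra! hne
  -- The cutoff `χ` vanishes on the ball of radius `R` and equals `1` on the sphere of radius `K`.
  let χ : E → ℝ := fun x => Real.smoothTransition (‖x‖ ^ 2 - R ^ 2)
  let G : E → E := fun x => (1 - χ x) • F x + χ x • x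
  let K : ℝ := |R| + 1
  have hK : 0 < K := by positivity
  have hχ : ContDiff ℝ 1 χ :=
    Real.smoothTransition.contDiff.comp ((contDiff_norm_sq ℝ).sub contDiff_const)
  have hG : ContDiff ℝ 1 G :=
    ((contDiff_const.sub hχ).smul hF).add (hχ.smul contDiff_id)
  have hG0 (x : E) : G x ≠ 0 := by
    by_cases hx : R ≤ ‖x‖
    · intro h
      have h1 : inner ℝ (G x) x = (1 - χ x) * inner ℝ (F x) x + χ x * ‖x‖ ^ 2 := by
        simp only [G, inner_add_left, real_inner_smul_left, real_inner_self_eq_norm_sq]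
      rw [h, inner_zero_left] at h1
      have h2 : 0 ≤ χ x := Real.smoothTransition.nonneg _
      have h3 : χ x ≤ 1 := Real.smoothTransition.le_one _
      have h4 := hpos x hx
      have hx0 : 0 < ‖x‖ ^ 2 := by
        have : x ≠ 0 := by rintro rfl; simp at h4
        positivity
      rcases h2.eq_or_lt with h5 | h5
      · rw [← h5] at h1; linarith
      · nlinarith [mul_pos h5 hx0, mul_nonneg (sub_nonneg.2 h3) h4.le]
    · have h1 : χ x = 0 := Real.smoothTransition.zero_of_nonpos (by
        push Not at hx
        nlinarith [norm_nonneg x])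
      simpa [G, h1] using hne x
  have hGid (x : E) (hx : ‖x‖ = K) : G x = x := by
    have h1 : χ x = 1 := Real.smoothTransition.one_of_one_le (by
      rw [hx]; simp only [K]; nlinarith [sq_abs R, abs_nonneg R])
    simp [G, h1]
  refine not_exists_contDiff_retraction_sphere (f := fun x => (K / ‖G x‖) • G x) hK ?_ ?_ ?_
  · exact (contDiff_const.div (hG.norm ℝ hG0) fun x => norm_ne_zero_iff.2 (hG0 x)).smul hG
  · intro x
    rw [norm_smul, norm_div, norm_norm, Real.norm_of_nonneg hK.le,
      div_mul_cancel₀ _ (norm_ne_zero_iff.2 (hG0 x))]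
  · intro x hx
    rw [hGid x hx, hx, div_self hK.ne', one_smul]

end Retraction

/-! ### Coercivity of the cubic coupling -/

section Coercive

/-- A `C¹` map of quartic growth against the identity stays surjective after any linear
perturbation: far out the quartic term dominates. -/
lemma exists_add_eq_of_quartic_coercive {E : Type*} [NormedAddCommGroup E] [InnerProductSpace ℝ E]
    [FiniteDimensional ℝ E] {Q : E → E} (hQ : ContDiff ℝ 1 Q) {c : ℝ} (hc : 0 < c)
    (hcoer : ∀ z, c * ‖z‖ ^ 4 ≤ inner ℝ (Q z) z) (L : E →ₗ[ℝ] E) (g : E) :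
    ∃ z, Q z + L z = g := by
  let L' := LinearMap.toContinuousLinearMap L
  have hF : ContDiff ℝ 1 fun z => Q z + L' z - g :=
    (hQ.add L'.contDiff).sub contDiff_const
  -- For `‖z‖ ≥ 1` the affine terms pair to at most `(‖L'‖ + ‖g‖) ‖z‖ ^ 2`, which is less than
  -- `c ‖z‖ ^ 4` beyond this radius.
  obtain ⟨z, hz⟩ := exists_zero_of_inner_pos hF (R := 1 + (‖L'‖ + ‖g‖) / c) (by
    intro z hz
    have h1 := hcoer z
    have h2 : -(‖L'‖ * ‖z‖ ^ 2) ≤ inner ℝ (L' z) z := by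
      have := (abs_le.1 (abs_real_inner_le_norm (L' z) z)).1
      have := mul_le_mul_of_nonneg_right (L'.le_opNorm z) (norm_nonneg z)
      nlinarith
    have h3 : inner ℝ g z ≤ ‖g‖ * ‖z‖ := real_inner_le_norm g z
    have h4 : 0 ≤ (‖L'‖ + ‖g‖) / c := by positivity
    have h5 : 1 ≤ ‖z‖ := by linarith
    have h6 : ‖L'‖ + ‖g‖ < c * ‖z‖ := by
      have : (‖L'‖ + ‖g‖) / c < ‖z‖ := by linarith
      rwa [div_lt_iff₀' hc] at this
    rw [inner_sub_left, inner_add_left]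
    have h7 : ‖g‖ * ‖z‖ ≤ ‖g‖ * ‖z‖ ^ 2 :=
      mul_le_mul_of_nonneg_left (by nlinarith) (norm_nonneg g)
    have h8 : (‖L'‖ + ‖g‖) * ‖z‖ ^ 2 < c * ‖z‖ * ‖z‖ ^ 2 :=
      mul_lt_mul_of_pos_right h6 (by positivity)
    have h9 : c * ‖z‖ * ‖z‖ ^ 2 ≤ c * ‖z‖ ^ 4 := by
      have : c * ‖z‖ ^ 3 * 1 ≤ c * ‖z‖ ^ 3 * ‖z‖ :=
        mul_le_mul_of_nonneg_left h5 (by positivity)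
      nlinarith
    nlinarith)
  exact ⟨z, sub_eq_zero.1 hz⟩

lemma pow_three_mul_le {p q : ℝ} (hp : 0 < p) (hq : 0 < q) (r s : ℝ) :
    r ^ 3 * s ≤
      (p ^ 2 + 1 / (16 * p ^ 2 * q ^ 2)) * r ^ 4 + q ^ 2 / (4 * p ^ 2) * s ^ 4 := by
  have h : (p ^ 2 + 1 / (16 * p ^ 2 * q ^ 2)) * r ^ 4 + q ^ 2 / (4 * p ^ 2) * s ^ 4 - r ^ 3 * s =
      (p * r ^ 2 - r * s / (2 * p)) ^ 2 +
        1 / (4 * p ^ 2) * (q * s ^ 2 - r ^ 2 / (2 * q)) ^ 2 := by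
    field_simp
    ring
  have : 0 ≤ (p * r ^ 2 - r * s / (2 * p)) ^ 2 +
        1 / (4 * p ^ 2) * (q * s ^ 2 - r ^ 2 / (2 * q)) ^ 2 := by positivity
  linarith

/-- The conditions on `μ₁` and `μ₂` bound both `r³ s` and `r s³` at once, whereas the coupling
contributes at most the larger of the two; the bound on the other one is left as a surplus. -/
lemma exists_quartic_lower_bound {μ₁ μ₂ : ℝ}
    (hcond : ∃ ε₁ ε₂ ε₃ ε₄ : ℝ, 0 < ε₁ ∧ 0 < ε₂ ∧ 0 < ε₃ ∧ 0 < ε₄ ∧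
      ε₁ ^ 2 + 1 / (16 * ε₁ ^ 2 * ε₂ ^ 2) + ε₄ ^ 2 / (4 * ε₃ ^ 2) ≤ μ₁ ∧
      ε₃ ^ 2 + 1 / (16 * ε₃ ^ 2 * ε₄ ^ 2) + ε₂ ^ 2 / (4 * ε₁ ^ 2) ≤ μ₂) :
    ∃ c > 0, ∀ r s d : ℝ, 0 ≤ r → 0 ≤ s → |d| ≤ r * s →
      c * (r ^ 4 + s ^ 4) ≤ μ₁ * r ^ 4 + μ₂ * s ^ 4 + (r ^ 2 - s ^ 2) * d := by
  obtain ⟨ε₁, ε₂, ε₃, ε₄, h₁, h₂, h₃, h₄, hμ₁, hμ₂⟩ := hcond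
  have hY₁ := pow_three_mul_le h₁ h₂
  have hY₂ := pow_three_mul_le h₃ h₄
  have hP₁ : 0 < ε₁ ^ 2 + 1 / (16 * ε₁ ^ 2 * ε₂ ^ 2) := by positivity
  have hP₂ : 0 < ε₃ ^ 2 + 1 / (16 * ε₃ ^ 2 * ε₄ ^ 2) := by positivity
  have hQ₁ : 0 < ε₂ ^ 2 / (4 * ε₁ ^ 2) := by positivity
  have hQ₂ : 0 < ε₄ ^ 2 / (4 * ε₃ ^ 2) := by positivity
  generalize ε₁ ^ 2 + 1 / (16 * ε₁ ^ 2 * ε₂ ^ 2) = P₁ at *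
  generalize ε₃ ^ 2 + 1 / (16 * ε₃ ^ 2 * ε₄ ^ 2) = P₂ at *
  generalize ε₂ ^ 2 / (4 * ε₁ ^ 2) = Q₁ at *
  generalize ε₄ ^ 2 / (4 * ε₃ ^ 2) = Q₂ at *
  refine ⟨min (min P₁ P₂) (min Q₁ Q₂), by positivity, fun r s d hr hs hd => ?_⟩
  have hr4 : 0 ≤ r ^ 4 := by positivity
  have hs4 : 0 ≤ s ^ 4 := by positivity
  have hμr := mul_le_mul_of_nonneg_right hμ₁ hr4
  have hμs := mul_le_mul_of_nonneg_right hμ₂ hs4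
  have hrs : 0 ≤ r * s := mul_nonneg hr hs
  set c := min (min P₁ P₂) (min Q₁ Q₂)
  have hcP₁ : c ≤ P₁ := (min_le_left _ _).trans (min_le_left _ _)
  have hcP₂ : c ≤ P₂ := (min_le_left _ _).trans (min_le_right _ _)
  have hcQ₁ : c ≤ Q₁ := (min_le_right _ _).trans (min_le_left _ _)
  have hcQ₂ : c ≤ Q₂ := (min_le_right _ _).trans (min_le_right _ _)
  obtain ⟨hd1, hd2⟩ := abs_le.1 hd
  -- Only one of the two Young bounds is spent; the surplus is `Q₂ r⁴ + P₂ s⁴` in the first case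
  -- and `P₁ r⁴ + Q₁ s⁴` in the second.
  rcases le_total s r with h | h
  · have h5 : 0 ≤ r ^ 2 - s ^ 2 := by nlinarith
    have h6 : -(r ^ 3 * s) ≤ (r ^ 2 - s ^ 2) * d := by
      nlinarith [mul_le_mul_of_nonneg_left hd1 h5, mul_nonneg hrs (sq_nonneg s)]
    nlinarith [hY₁ r s, mul_le_mul_of_nonneg_right hcQ₂ hr4, mul_le_mul_of_nonneg_right hcP₂ hs4]
  · have h5 : 0 ≤ s ^ 2 - r ^ 2 := by nlinarith
    have h6 : -(s ^ 3 * r) ≤ (r ^ 2 - s ^ 2) * d := by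
      nlinarith [mul_le_mul_of_nonneg_left hd2 h5, mul_nonneg hrs (sq_nonneg r)]
    nlinarith [hY₂ s r, mul_le_mul_of_nonneg_right hcP₁ hr4, mul_le_mul_of_nonneg_right hcQ₁ hs4]

/-- The pointwise nonlinearity `(μ + iζ) |u|² u - i |u|² w` of the equation for `u`. -/
noncomputable def cubicTerm (μ ζ : ℝ) (u w : ℂ) : ℂ :=
  ((μ : ℂ) + Complex.I * (ζ : ℂ)) * (((‖u‖ ^ 2 : ℝ) : ℂ) * u)
    - Complex.I * (((‖u‖ ^ 2 : ℝ) : ℂ) * w)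

lemma inner_cubicTerm_add (μ₁ μ₂ ζ₁ ζ₂ : ℝ) (u w : ℂ) :
    inner ℝ (cubicTerm μ₁ ζ₁ u w) u + inner ℝ (cubicTerm μ₂ ζ₂ w u) w =
      μ₁ * ‖u‖ ^ 4 + μ₂ * ‖w‖ ^ 4 +
        (‖u‖ ^ 2 - ‖w‖ ^ 2) * (w * (starRingEnd ℂ) u).im := by
  have hu : ‖u‖ ^ 4 = (u.re * u.re + u.im * u.im) ^ 2 := by
    rw [← Complex.normSq_apply, ← Complex.sq_norm]; ring
  have hw : ‖w‖ ^ 4 = (w.re * w.re + w.im * w.im) ^ 2 := by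
    rw [← Complex.normSq_apply, ← Complex.sq_norm]; ring
  rw [hu, hw]
  simp only [Complex.inner, cubicTerm, Complex.sq_norm, Complex.normSq_apply, Complex.mul_re,
    Complex.mul_im, Complex.conj_re, Complex.conj_im, Complex.sub_re, Complex.sub_im,
    Complex.add_re, Complex.add_im, Complex.ofReal_re, Complex.ofReal_im, Complex.I_re,
    Complex.I_im]
  ring

lemma contDiff_cubicTerm {E : Type*} [NormedAddCommGroup E] [NormedSpace ℝ E] (μ ζ : ℝ)
    {f g : E → ℂ} (hf : ContDiff ℝ 1 f) (hg : ContDiff ℝ 1 g) :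
    ContDiff ℝ 1 fun x => cubicTerm μ ζ (f x) (g x) := by
  have h : ContDiff ℝ 1 fun x => ((‖f x‖ ^ 2 : ℝ) : ℂ) :=
    Complex.ofRealCLM.contDiff.comp (hf.norm_sq ℝ)
  exact (contDiff_const.mul (h.mul hf)).sub (contDiff_const.mul (h.mul hg))

variable {ι : Type*} [Fintype ι]

lemma norm_pow_four_le (z : PiLp 2 fun _ : ι ⊕ ι => ℂ) :
    ‖z‖ ^ 4 ≤ Fintype.card (ι ⊕ ι) * ∑ i, (‖z (Sum.inl i)‖ ^ 4 + ‖z (Sum.inr i)‖ ^ 4) := by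
  have h := sq_sum_le_card_mul_sum_sq (s := Finset.univ) (f := fun k => ‖z k‖ ^ 2)
  have h1 : ‖z‖ ^ 4 = (∑ k, ‖z k‖ ^ 2) ^ 2 := by
    rw [← PiLp.norm_sq_eq_of_L2]; ring
  rw [h1]
  refine h.trans_eq ?_
  simp only [← pow_mul, Fintype.sum_sum_type, Finset.sum_add_distrib, Finset.card_univ]

/-- Solvability of the pointwise cubic system under arbitrary linear perturbations. -/
lemma exists_cubicTerm_add_eq {μ₁ μ₂ : ℝ} (ζ₁ ζ₂ : ℝ)
    (hcond : ∃ ε₁ ε₂ ε₃ ε₄ : ℝ, 0 < ε₁ ∧ 0 < ε₂ ∧ 0 < ε₃ ∧ 0 < ε₄ ∧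
      ε₁ ^ 2 + 1 / (16 * ε₁ ^ 2 * ε₂ ^ 2) + ε₄ ^ 2 / (4 * ε₃ ^ 2) ≤ μ₁ ∧
      ε₃ ^ 2 + 1 / (16 * ε₃ ^ 2 * ε₄ ^ 2) + ε₂ ^ 2 / (4 * ε₁ ^ 2) ≤ μ₂)
    (L₁ L₂ : (ι → ℂ) →ₗ[ℂ] (ι → ℂ)) (g₁ g₂ : ι → ℂ) :
    ∃ X Y : ι → ℂ, (fun i => cubicTerm μ₁ ζ₁ (X i) (Y i)) + L₁ X = g₁ ∧
      (fun i => cubicTerm μ₂ ζ₂ (Y i) (X i)) + L₂ Y = g₂ := by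
  obtain ⟨c, hc, hq⟩ := exists_quartic_lower_bound hcond
  let E := PiLp 2 fun _ : ι ⊕ ι => ℂ
  let Q : E → E := fun z => WithLp.toLp 2 (Sum.elim
    (fun i => cubicTerm μ₁ ζ₁ (z (Sum.inl i)) (z (Sum.inr i)))
    (fun i => cubicTerm μ₂ ζ₂ (z (Sum.inr i)) (z (Sum.inl i))))
  let L : E →ₗ[ℝ] E :=
    { toFun := fun z => WithLp.toLp 2 (Sum.elim
        (L₁ fun i => z (Sum.inl i)) (L₂ fun i => z (Sum.inr i)))
      map_add' := by
        intro z w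
        have h1 := L₁.map_add (fun i => z (Sum.inl i)) (fun i => w (Sum.inl i))
        have h2 := L₂.map_add (fun i => z (Sum.inr i)) (fun i => w (Sum.inr i))
        ext (i | i)
        · exact congrFun h1 i
        · exact congrFun h2 i
      map_smul' := by
        intro t z
        have h1 := L₁.map_smul (t : ℂ) (fun i => z (Sum.inl i))
        have h2 := L₂.map_smul (t : ℂ) (fun i => z (Sum.inr i))
        ext (i | i)
        · exact congrFun h1 i
        · exact congrFun h2 i }
  have hQ : ContDiff ℝ 1 Q := by
    have hcoord (k : ι ⊕ ι) : ContDiff ℝ 1 fun z : E => z k :=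
      (PiLp.proj (𝕜 := ℝ) 2 (fun _ : ι ⊕ ι => ℂ) k).contDiff
    refine (contDiff_piLp 2).2 ?_
    rintro (i | i)
    · exact contDiff_cubicTerm _ _ (hcoord _) (hcoord _)
    · exact contDiff_cubicTerm _ _ (hcoord _) (hcoord _)
  -- The summand `1` keeps the constant meaningful when there are no interior points.
  have hcoer (z : E) : c / (Fintype.card (ι ⊕ ι) + 1) * ‖z‖ ^ 4 ≤ inner ℝ (Q z) z := by
    have h1 : inner ℝ (Q z) z = ∑ i, (inner ℝ (cubicTerm μ₁ ζ₁ (z (Sum.inl i)) (z (Sum.inr i)))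
        (z (Sum.inl i)) + inner ℝ (cubicTerm μ₂ ζ₂ (z (Sum.inr i)) (z (Sum.inl i)))
        (z (Sum.inr i))) := by
      rw [PiLp.inner_apply, Fintype.sum_sum_type, ← Finset.sum_add_distrib]
      rfl
    have h2 : c * ∑ i, (‖z (Sum.inl i)‖ ^ 4 + ‖z (Sum.inr i)‖ ^ 4) ≤ inner ℝ (Q z) z := by
      rw [h1, Finset.mul_sum]
      refine Finset.sum_le_sum fun i _ => ?_
      rw [inner_cubicTerm_add]
      refine hq _ _ _ (norm_nonneg _) (norm_nonneg _) ?_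
      refine (Complex.abs_im_le_norm _).trans_eq ?_
      rw [norm_mul, Complex.norm_conj, mul_comm]
    refine le_trans ?_ h2
    have h3 := norm_pow_four_le z
    have h4 : 0 ≤ ∑ i, (‖z (Sum.inl i)‖ ^ 4 + ‖z (Sum.inr i)‖ ^ 4) := by positivity
    rw [div_mul_eq_mul_div, div_le_iff₀ (by positivity)]
    nlinarith
  obtain ⟨z, hz⟩ := exists_add_eq_of_quartic_coercive hQ (by positivity) hcoer L
    (WithLp.toLp 2 (Sum.elim g₁ g₂))
  refine ⟨fun i => z (Sum.inl i), fun i => z (Sum.inr i), ?_, ?_⟩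
  · ext i
    exact congrArg (fun w : E => w (Sum.inl i)) hz
  · ext i
    exact congrArg (fun w : E => w (Sum.inr i)) hz

end Coercive

/-! ### The time step of the difference scheme -/

section Scheme

lemma opH_eq {h : ℝ} (hh : h ≠ 0) (α : ℝ) (U : ℤ → ℂ) (j : ℤ) :
    opH α h U j = U j + (rho2 α : ℂ) * (U (j + 1) - 2 * U j + U (j - 1)) := by
  have : (h : ℂ) ≠ 0 := by exact_mod_cast hh
  unfold opH deltaX2
  field_simp

/-- The compact operator `opH` as a linear map on grid functions. -/
noncomputable def opHLinear (α h : ℝ) : (ℤ → ℂ) →ₗ[ℂ] (ℤ → ℂ) where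
  toFun := opH α h
  map_add' U V := by
    ext j
    simp only [opH, deltaX2, Pi.add_apply]
    ring
  map_smul' c U := by
    ext j
    simp only [opH, deltaX2, Pi.smul_apply, smul_eq_mul, RingHom.id_apply]
    ring

/-- The fractional difference operator `opA` as a linear map on grid functions. -/
noncomputable def opALinear (α h : ℝ) (M : ℕ) : (ℤ → ℂ) →ₗ[ℂ] (ℤ → ℂ) where
  toFun := opA α h M
  map_add' U V := by
    ext j
    simp only [opA, opAL, opAR, Pi.add_apply, mul_add, Finset.sum_add_distrib]
    ring
  map_smul' c U := by
    ext j
    simp only [opA, opAL, opAR, Pi.smul_apply, smul_eq_mul, RingHom.id_apply,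
      mul_left_comm _ c, ← Finset.mul_sum, ← mul_add]

/-- The interior grid points `1 ≤ j ≤ M - 1`. -/
abbrev Interior (M : ℕ) : Type := Finset.Icc (1 : ℤ) ((M : ℤ) - 1)

/-- Extension of a function on the interior grid points by zero. -/
noncomputable abbrev extendZero (M : ℕ) : (Interior M → ℂ) →ₗ[ℂ] (ℤ → ℂ) :=
  Function.ExtendByZero.linearMap ℂ (Subtype.val : Interior M → ℤ)

lemma extendZero_coe {M : ℕ} (X : Interior M → ℂ) (i : Interior M) : extendZero M X i = X i :=
  Subtype.val_injective.extend_apply _ _ _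

lemma extendZero_of_notMem {M : ℕ} (X : Interior M → ℂ) {j : ℤ}
    (hj : ¬ (1 ≤ j ∧ j ≤ (M : ℤ) - 1)) : extendZero M X j = 0 := by
  refine Function.extend_apply' _ _ _ ?_
  rintro ⟨i, rfl⟩
  exact hj (Finset.mem_Icc.1 i.2)

lemma eq_extendZero {M : ℕ} {u : ℤ → ℂ} (hu : ∀ j : ℤ, ¬ (1 ≤ j ∧ j ≤ (M : ℤ) - 1) → u j = 0)
    {X : Interior M → ℂ} (hX : ∀ i : Interior M, X i = u i) : extendZero M X = u := by
  ext j
  by_cases hj : 1 ≤ j ∧ j ≤ (M : ℤ) - 1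
  · exact (extendZero_coe X ⟨j, Finset.mem_Icc.2 hj⟩).trans (hX _)
  · rw [extendZero_of_notMem X hj, hu j hj]

/-- The compression of an operator on grid functions to the functions on the interior points. -/
noncomputable def compress (M : ℕ) (T : (ℤ → ℂ) →ₗ[ℂ] (ℤ → ℂ)) :
    (Interior M → ℂ) →ₗ[ℂ] (Interior M → ℂ) :=
  LinearMap.funLeft ℂ ℂ Subtype.val ∘ₗ T ∘ₗ extendZero M

lemma compress_apply {M : ℕ} (T : (ℤ → ℂ) →ₗ[ℂ] (ℤ → ℂ)) (X : Interior M → ℂ) (i : Interior M) :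
    compress M T X i = T (extendZero M X) i := rfl

lemma rho2_lt {α : ℝ} (hα1 : 1 < α) (hα2 : α ≤ 2) : rho2 α < 1 / 4 := by
  unfold rho2
  rw [div_lt_iff₀ (by linarith)]
  nlinarith [mul_nonneg (mul_nonneg (sub_pos.2 hα1).le (sub_pos.2 hα1).le) (sub_nonneg.2 hα2),
    sq_nonneg (α - 1), sq_nonneg (14 * (α - 1) - 1)]

/-- As `rho2 α < 1 / 4`, the compression of `opH` is strictly diagonally dominant. -/
lemma injective_compress_opHLinear {α h : ℝ} (hh : h ≠ 0) (hα1 : 1 < α) (hα2 : α ≤ 2) (M : ℕ) :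
    Function.Injective (compress M (opHLinear α h)) := by
  rw [injective_iff_map_eq_zero]
  intro X hX
  rcases isEmpty_or_nonempty (Interior M) with hI | hI
  · exact Subsingleton.elim _ _
  obtain ⟨i, hi⟩ := Finite.exists_max fun i => ‖X i‖
  have hmax (j : ℤ) : ‖extendZero M X j‖ ≤ ‖X i‖ := by
    by_cases hj : 1 ≤ j ∧ j ≤ (M : ℤ) - 1
    · rw [extendZero_coe X ⟨j, Finset.mem_Icc.2 hj⟩]
      exact hi _
    · rw [extendZero_of_notMem X hj, norm_zero]
      exact norm_nonneg _
  have h0 : opH α h (extendZero M X) i = 0 := congrFun hX i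
  rw [opH_eq hh, extendZero_coe] at h0
  have h1 : ((1 - 2 * rho2 α : ℝ) : ℂ) * X i =
      -((rho2 α : ℂ) * (extendZero M X (i + 1) + extendZero M X (i - 1))) := by
    push_cast
    linear_combination h0
  have h2 : |1 - 2 * rho2 α| * ‖X i‖ ≤ |rho2 α| * (‖X i‖ + ‖X i‖) := by
    have := congrArg norm h1
    rw [norm_neg, norm_mul, norm_mul, Complex.norm_real, Complex.norm_real, Real.norm_eq_abs,
      Real.norm_eq_abs] at this
    rw [this]
    exact mul_le_mul_of_nonneg_left
      ((norm_add_le _ _).trans (add_le_add (hmax _) (hmax _))) (abs_nonneg _)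
  have h3 : 2 * |rho2 α| < |1 - 2 * rho2 α| := by
    have := rho2_lt hα1 hα2
    rw [abs_of_pos (by linarith : 0 < 1 - 2 * rho2 α)]
    rcases abs_cases (rho2 α) with h | h <;> linarith
  have h4 : ‖X i‖ = 0 := by
    by_contra h
    have := (norm_nonneg (X i)).lt_of_ne' h
    nlinarith
  ext k
  exact norm_le_zero_iff.1 ((hi k).trans_eq h4)

lemma extendZero_cubicTerm {M : ℕ} (μ ζ : ℝ) (X Y : Interior M → ℂ) :
    extendZero M (fun i => cubicTerm μ ζ (X i) (Y i)) =
      ((μ : ℂ) + Complex.I * (ζ : ℂ)) • sqMul (extendZero M X) (extendZero M X) -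
        Complex.I • sqMul (extendZero M X) (extendZero M Y) := by
  refine eq_extendZero (fun j hj => ?_) fun i => ?_
  · simp [sqMul, extendZero_of_notMem X hj]
  · simp only [Pi.sub_apply, Pi.smul_apply, sqMul, extendZero_coe, smul_eq_mul, cubicTerm]

/-- One time step of the scheme, in terms of the midpoint values `X` and `Y`. After inverting the
compact operator, the nonlinearity is pointwise and everything else is affine. -/
lemma exists_midpoint {α h : ℝ} (hh : h ≠ 0) (hα1 : 1 < α) (hα2 : α ≤ 2) (τ : ℝ) (M : ℕ)
    (β₁ β₂ η₁ η₂ ζ₁ ζ₂ γ₁ γ₂ : ℝ) {μ₁ μ₂ : ℝ}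
    (hcond : ∃ ε₁ ε₂ ε₃ ε₄ : ℝ, 0 < ε₁ ∧ 0 < ε₂ ∧ 0 < ε₃ ∧ 0 < ε₄ ∧
      ε₁ ^ 2 + 1 / (16 * ε₁ ^ 2 * ε₂ ^ 2) + ε₄ ^ 2 / (4 * ε₃ ^ 2) ≤ μ₁ ∧
      ε₃ ^ 2 + 1 / (16 * ε₃ ^ 2 * ε₄ ^ 2) + ε₂ ^ 2 / (4 * ε₁ ^ 2) ≤ μ₂)
    {u v : ℤ → ℂ} (hu : ∀ j : ℤ, ¬ (1 ≤ j ∧ j ≤ (M : ℤ) - 1) → u j = 0)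
    (hv : ∀ j : ℤ, ¬ (1 ≤ j ∧ j ≤ (M : ℤ) - 1) → v j = 0) :
    ∃ X Y : ℤ → ℂ, (∀ j : ℤ, ¬ (1 ≤ j ∧ j ≤ (M : ℤ) - 1) → X j = 0 ∧ Y j = 0) ∧
      ∀ j : ℤ, 1 ≤ j → j ≤ (M : ℤ) - 1 →
        (opH α h ((2 / τ : ℂ) • (X - u)) j =
          ((β₁ : ℂ) + Complex.I * (η₁ : ℂ)) * opA α h M X j + (γ₁ : ℂ) * opH α h X j
            - ((μ₁ : ℂ) + Complex.I * (ζ₁ : ℂ)) * opH α h (sqMul X X) j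
            + Complex.I * opH α h (sqMul X Y) j) ∧
        opH α h ((2 / τ : ℂ) • (Y - v)) j =
          ((β₂ : ℂ) + Complex.I * (η₂ : ℂ)) * opA α h M Y j + (γ₂ : ℂ) * opH α h Y j
            - ((μ₂ : ℂ) + Complex.I * (ζ₂ : ℂ)) * opH α h (sqMul Y Y) j
            + Complex.I * opH α h (sqMul Y X) j := by
  let H := LinearEquiv.ofInjectiveEndo _ (injective_compress_opHLinear hh hα1 hα2 M)
  have hH (X : Interior M → ℂ) : H X = compress M (opHLinear α h) X := rfl
  let G : ℝ → ℝ → ℝ → (Interior M → ℂ) →ₗ[ℂ] (Interior M → ℂ) := fun β η γ =>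
    compress M ((2 / τ : ℂ) • opHLinear α h - ((β : ℂ) + Complex.I * (η : ℂ)) • opALinear α h M -
      (γ : ℂ) • opHLinear α h)
  obtain ⟨X, Y, hX, hY⟩ := exists_cubicTerm_add_eq ζ₁ ζ₂ hcond
    (H.symm.toLinearMap ∘ₗ G β₁ η₁ γ₁) (H.symm.toLinearMap ∘ₗ G β₂ η₂ γ₂)
    (fun i : Interior M => (2 / τ : ℂ) • u i) (fun i : Interior M => (2 / τ : ℂ) • v i)
  have key (β η μ ζ γ : ℝ) (u : ℤ → ℂ) (X Y : Interior M → ℂ)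
      (hu : ∀ j : ℤ, ¬ (1 ≤ j ∧ j ≤ (M : ℤ) - 1) → u j = 0)
      (hX : (fun i => cubicTerm μ ζ (X i) (Y i)) + (H.symm.toLinearMap ∘ₗ G β η γ) X =
        fun i : Interior M => (2 / τ : ℂ) • u i) (j : ℤ) (hj1 : 1 ≤ j) (hj2 : j ≤ (M : ℤ) - 1) :
      opH α h ((2 / τ : ℂ) • (extendZero M X - u)) j =
          ((β : ℂ) + Complex.I * (η : ℂ)) * opA α h M (extendZero M X) j
            + (γ : ℂ) * opH α h (extendZero M X) j
            - ((μ : ℂ) + Complex.I * (ζ : ℂ)) *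
              opH α h (sqMul (extendZero M X) (extendZero M X)) j
            + Complex.I * opH α h (sqMul (extendZero M X) (extendZero M Y)) j := by
    have h1 := congrArg H hX
    rw [map_add, LinearMap.comp_apply, LinearEquiv.coe_coe, LinearEquiv.apply_symm_apply] at h1
    have h2 := congrFun h1 ⟨j, Finset.mem_Icc.2 ⟨hj1, hj2⟩⟩
    rw [Pi.add_apply, hH, hH, compress_apply, compress_apply, compress_apply,
      extendZero_cubicTerm, eq_extendZero (u := (2 / τ : ℂ) • u)
        (X := fun i : Interior M => (2 / τ : ℂ) • u i)
        (fun j hj => by simp [hu j hj]) fun _ => rfl] at h2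
    simp only [map_sub, map_smul, LinearMap.sub_apply, LinearMap.smul_apply, Pi.sub_apply,
      Pi.smul_apply, smul_eq_mul] at h2
    have h3 : opH α h ((2 / τ : ℂ) • (extendZero M X - u)) j =
        (2 / τ : ℂ) * (opHLinear α h (extendZero M X) j - opHLinear α h u j) := by
      change opHLinear α h _ j = _
      simp only [map_sub, map_smul, Pi.sub_apply, Pi.smul_apply, smul_eq_mul]
    rw [h3]
    change _ = ((β : ℂ) + Complex.I * (η : ℂ)) * opALinear α h M (extendZero M X) j
            + (γ : ℂ) * opHLinear α h (extendZero M X) j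
            - ((μ : ℂ) + Complex.I * (ζ : ℂ)) *
              opHLinear α h (sqMul (extendZero M X) (extendZero M X)) j
            + Complex.I * opHLinear α h (sqMul (extendZero M X) (extendZero M Y)) j
    linear_combination h2
  exact ⟨extendZero M X, extendZero M Y,
    fun j hj => ⟨extendZero_of_notMem X hj, extendZero_of_notMem Y hj⟩,
    fun j hj1 hj2 => ⟨key β₁ η₁ μ₁ ζ₁ γ₁ u X Y hu hX j hj1 hj2,
      key β₂ η₂ μ₂ ζ₂ γ₂ v Y X hv hY j hj1 hj2⟩⟩

/-- A solution of the midpoint equation yields a solution of the scheme, the new time level being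
`2 X - U k`. -/
lemma schemeEq_of_midpoint {α h τ : ℝ} {M : ℕ} {β η μ ζ γ : ℝ} {U W : ℕ → ℤ → ℂ} {k : ℕ} {j : ℤ}
    {X Y : ℤ → ℂ} (hU : U (k + 1) = (2 : ℂ) • X - U k) (hW : W (k + 1) = (2 : ℂ) • Y - W k)
    (hX : opH α h ((2 / τ : ℂ) • (X - U k)) j =
      ((β : ℂ) + Complex.I * (η : ℂ)) * opA α h M X j + (γ : ℂ) * opH α h X j
        - ((μ : ℂ) + Complex.I * (ζ : ℂ)) * opH α h (sqMul X X) j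
        + Complex.I * opH α h (sqMul X Y) j) :
    SchemeEq α h τ M β η μ ζ γ U W k j := by
  have h1 : mid U k = X := by
    ext i
    simp [mid, hU]
  have h2 : mid W k = Y := by
    ext i
    simp [mid, hW]
  have h3 : deltaT τ U k = (2 / τ : ℂ) • (X - U k) := by
    ext i
    simp only [deltaT, hU, Pi.sub_apply, Pi.smul_apply, smul_eq_mul]
    ring
  rw [SchemeEq, h1, h2, h3]
  exact hX

lemma apply_grid_eq_zero {a b : ℝ} (hab : a < b) {M : ℕ} (hM : 0 < M) {f : ℝ → ℂ}
    (hf : ∀ x : ℝ, x ∉ Set.Ioo a b → f x = 0) {j : ℤ} (hj : ¬ (1 ≤ j ∧ j ≤ (M : ℤ) - 1)) :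
    f (a + (j : ℝ) * ((b - a) / M)) = 0 := by
  refine hf _ fun hx => hj ?_
  have hM' : (0 : ℝ) < M := by exact_mod_cast hM
  have hh : 0 < (b - a) / M := div_pos (sub_pos.2 hab) hM'
  have h1 : (0 : ℝ) < j := by
    have : 0 < (j : ℝ) * ((b - a) / M) := by linarith [hx.1]
    exact (pos_iff_pos_of_mul_pos this).2 hh
  have h2 : (j : ℝ) < M := by
    have h : (j : ℝ) * ((b - a) / M) < M * ((b - a) / M) := by
      rw [mul_div_cancel₀ _ hM'.ne']; linarith [hx.2]
    exact lt_of_mul_lt_mul_right h hh.le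
  have h1' : 0 < j := by exact_mod_cast h1
  have h2' : j < M := by exact_mod_cast h2
  omega

end Scheme

end CoupledGL

theorem mainTheorem8
    (a b T : ℝ) (hab : a < b) (hT : 0 < T)
    (M N : ℕ) (hM : 0 < M) (hN : 0 < N)
    (α : ℝ) (hα1 : 1 < α) (hα2 : α ≤ 2)
    (β₁ β₂ η₁ η₂ μ₁ μ₂ ζ₁ ζ₂ γ₁ γ₂ : ℝ)
    (hβ₁ : 0 < β₁) (hβ₂ : 0 < β₂) (hη₁ : 0 < η₁) (hη₂ : 0 < η₂)
    (hμ₁ : 0 ≤ μ₁) (hμ₂ : 0 ≤ μ₂) (hζ₁ : 0 < ζ₁) (hζ₂ : 0 < ζ₂)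
    (hcond : ∃ ε₁ ε₂ ε₃ ε₄ : ℝ, 0 < ε₁ ∧ 0 < ε₂ ∧ 0 < ε₃ ∧ 0 < ε₄ ∧
      ε₁ ^ 2 + 1 / (16 * ε₁ ^ 2 * ε₂ ^ 2) + ε₄ ^ 2 / (4 * ε₃ ^ 2) ≤ μ₁ ∧
      ε₃ ^ 2 + 1 / (16 * ε₃ ^ 2 * ε₄ ^ 2) + ε₂ ^ 2 / (4 * ε₁ ^ 2) ≤ μ₂)
    (hτ : T / N * max |γ₁| |γ₂| ≤ 1 / 2)
    (u₀ v₀ : ℝ → ℂ)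
    (hu₀ : ∀ x : ℝ, x ∉ Set.Ioo a b → u₀ x = 0)
    (hv₀ : ∀ x : ℝ, x ∉ Set.Ioo a b → v₀ x = 0) :
    ∃ U V : ℕ → ℤ → ℂ,
      CoupledGL.IsSchemeSolution a b T M N α β₁ β₂ η₁ η₂ μ₁ μ₂ ζ₁ ζ₂ γ₁ γ₂ u₀ v₀ U V := by
  have hh : (b - a) / (M : ℝ) ≠ 0 :=
    (div_pos (sub_pos.2 hab) (by exact_mod_cast hM)).ne'
  -- A time level is a pair of grid functions vanishing off the interior points.
  let S := {p : (ℤ → ℂ) × (ℤ → ℂ) //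
    ∀ j : ℤ, ¬ (1 ≤ j ∧ j ≤ (M : ℤ) - 1) → p.1 j = 0 ∧ p.2 j = 0}
  choose X Y hXY hX using fun p : S =>
    CoupledGL.exists_midpoint hh hα1 hα2 (T / N) M β₁ β₂ η₁ η₂ ζ₁ ζ₂
      γ₁ γ₂ hcond (fun j hj => (p.2 j hj).1) (fun j hj => (p.2 j hj).2)
  let step : S → S := fun p => ⟨((2 : ℂ) • X p - p.1.1, (2 : ℂ) • Y p - p.1.2), fun j hj => by
    simp [hXY p j hj, p.2 j hj]⟩
  let p₀ : S := ⟨(fun j => u₀ (a + (j : ℝ) * ((b - a) / M)),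
    fun j => v₀ (a + (j : ℝ) * ((b - a) / M))), fun j hj =>
      ⟨CoupledGL.apply_grid_eq_zero hab hM hu₀ hj,
        CoupledGL.apply_grid_eq_zero hab hM hv₀ hj⟩⟩
  let p : ℕ → S := fun k => step^[k] p₀
  have hp (k : ℕ) : p (k + 1) = step (p k) := Function.iterate_succ_apply' _ _ _
  have hU (k : ℕ) : (p (k + 1)).1.1 = (2 : ℂ) • X (p k) - (p k).1.1 := by rw [hp]
  have hV (k : ℕ) : (p (k + 1)).1.2 = (2 : ℂ) • Y (p k) - (p k).1.2 := by rw [hp]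
  refine ⟨fun k => (p k).1.1, fun k => (p k).1.2, ?_, ?_, fun _ => rfl, fun _ => rfl,
    fun k _ j hj => ((p k).2 j hj).1, fun k _ j hj => ((p k).2 j hj).2⟩
  · exact fun k _ j hj1 hj2 => CoupledGL.schemeEq_of_midpoint (U := fun k => (p k).1.1)
      (W := fun k => (p k).1.2) (hU k) (hV k) (hX (p k) j hj1 hj2).1
  · exact fun k _ j hj1 hj2 => CoupledGL.schemeEq_of_midpoint (U := fun k => (p k).1.2)
      (W := fun k => (p k).1.1) (hV k) (hU k) (hX (p k) j hj1 hj2).2
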